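/- All Banach spaces are real. Let $V$ be a Banach space with a normalized, $1$-unconditional, shrinking basis $(v_n)$, and let $Z$ be a Banach space with a shrinking finite dimensional decomposition (FDD) $E=(E_n)$ which satisfies subsequential $V$-upper block estimates in $Z$. Then $Sz(Z)\le Sz(V)$. Here the following notions are used. * An FDD for $Z$ is a sequence $E=(E_n)$ of finite dimensional subspaces such that every $z\in Z$ has a unique expansion $z=\sum_n z_n$ with $z_n\in E_n$ for all $n$; put $P_n z=z_n$ and $\operatorname{supp}_E z=\{n: P_nz\ne 0\}$. The FDD is shrinking if the linear span of the functionals $f\circ P_n$, $n\in\mathbb N$, $f\in E_n^*$, is norm dense in $Z^*$. A basis $(v_n)$ is shrinking if the FDD $(\operatorname{span}\{v_n\})$ is. It is normalized if $\|v_n\|=1$ for all $n$, and $1$-unconditional if $\|\sum \epsilon_n a_nv_n\|\le\|\sum a_nv_n\|$ for all finitely supported real $(a_n)$ and all signs $\epsilon_n=\pm1$. * A (finite or infinite) sequence $(z_n)$ of non-zero, finitely supported vectors is a block sequence of $E$ if $\max\operatorname{supp}_E z_n<\min\operatorname{supp}_E z_{n+1}$ for all appropriate $n$. $E$ satisfies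 subsequential $V$-upper block estimates in $Z$ if there is $C\ge 1$ such that for every normalized block sequence $(z_n)$ of $E$, with $m_n=\min\operatorname{supp}_E z_n$, one has $\|\sum a_nz_n\|\le C\|\sum a_nv_{m_n}\|$ for all finitely supported real $(a_n)$. * For $K\subset X^*$ weak$^*$ compact and $\varepsilon>0$ let $(K)'_\varepsilon$ be the set of those $z\in K$ such that $\operatorname{diam}(U\cap K)>\varepsilon$ (norm diameter) for every weak$^*$ neighbourhood $U$ of $z$. Put $P_0(K,\varepsilon)=K$, $P_{\alpha+1}(K,\varepsilon)=(P_\alpha(K,\varepsilon))'_\varepsilon$, and $P_\alpha(K,\varepsilon)=\bigcap_{\beta<\alpha}P_\beta(K,\varepsilon)$ for limit ordinals $\alpha$. Let $\eta(K,\varepsilon)$ be the least $\alpha<\omega_1$ with $P_\alpha(K,\varepsilon)=\varnothing$ if there is one, and $\omega_1$ otherwise. Then $Sz(X)=\sup_{\varepsilon>0}\eta(B_{X^*},\varepsilon)$, where $B_{X^*}$ is the closed unit ball of $X^*$. -/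

import Mathlib

open Filter Topology

noncomputable section

/-! ### Finite dimensional decompositions -/

/-- A finite dimensional decomposition of a normed space `Z`: finite dimensional subspaces `E n`
such that every `z` has a unique expansion `z = ∑ zₙ` (convergence in norm of the partial sums)
with `zₙ ∈ E n` for all `n`. Indices start at `0`. -/
structure FDD (Z : Type*) [NormedAddCommGroup Z] [NormedSpace ℝ Z] where
  /-- The subspaces of the decomposition. -/
  space : ℕ → Submodule ℝ Z
  finiteDimensional : ∀ n, FiniteDimensional ℝ (space n)
  existsUnique_expansion : ∀ z : Z, ∃! x : (n : ℕ) → space n,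
    Tendsto (fun N => ∑ n ∈ Finset.range N, (x n : Z)) atTop (𝓝 z)

namespace FDD

variable {Z : Type*} [NormedAddCommGroup Z] [NormedSpace ℝ Z]

/-- The `n`-th coordinate projection `Z → E n`, which takes `∑ zᵢ` to `zₙ`. -/
def coord (E : FDD Z) (n : ℕ) (z : Z) : E.space n :=
  (E.existsUnique_expansion z).choose n

theorem tendsto_coord (E : FDD Z) (z : Z) :
    Tendsto (fun N => ∑ n ∈ Finset.range N, (E.coord n z : Z)) atTop (𝓝 z) :=
  (E.existsUnique_expansion z).choose_spec.1

/-- The support of a vector with respect to an FDD. -/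
def supp (E : FDD Z) (z : Z) : Set ℕ := {n | E.coord n z ≠ 0}

/-- The image of the algebraic direct sum of the duals `(E n)*` in the dual `Z*`: the span of the
bounded functionals on `Z` of the form `f ∘ Pₙ`, with `Pₙ` a coordinate projection and `f` a linear
functional on the finite dimensional space `E n`. -/
def finiteDual (E : FDD Z) : Submodule ℝ (StrongDual ℝ Z) :=
  Submodule.span ℝ {g | ∃ (n : ℕ) (f : E.space n →ₗ[ℝ] ℝ), ∀ z, g z = f (E.coord n z)}

/-- An FDD is shrinking if the algebraic direct sum of the duals `(E n)*` is norm dense in `Z*`. -/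
def IsShrinking (E : FDD Z) : Prop :=
  E.finiteDual.topologicalClosure = ⊤

/-- `z 0, z 1, …` (the terms with index `< N`; infinitely many if `N = ⊤`) is a block sequence of
the FDD: the terms are non-zero and finitely supported, and
`max supp (z n) < min supp (z (n + 1))`. -/
structure IsBlockSequence (E : FDD Z) (N : ℕ∞) (z : ℕ → Z) : Prop where
  ne_zero : ∀ n : ℕ, (n : ℕ∞) < N → z n ≠ 0
  finite_supp : ∀ n : ℕ, (n : ℕ∞) < N → (E.supp (z n)).Finite
  lt : ∀ n : ℕ, ((n + 1 : ℕ) : ℕ∞) < N → ∀ i ∈ E.supp (z n), ∀ j ∈ E.supp (z (n + 1)), i < j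

end FDD

/-! ### Bases -/

namespace SchauderBasis

variable {V : Type*} [NormedAddCommGroup V] [NormedSpace ℝ V]

/-- A basis is regarded as the FDD whose `n`-th space is the span of the `n`-th basis vector. -/
def toFDD (v : SchauderBasis ℝ V) : FDD V where
  space n := Submodule.span ℝ {v n}
  finiteDimensional n := by infer_instance
  existsUnique_expansion x := by
    refine ⟨fun n => ⟨v.coord n x • v n, Submodule.smul_mem _ _ (Submodule.mem_span_singleton_self _)⟩,
      ?_, ?_⟩
    · have h := v.expansion x
      rw [HasSum, SummationFilter.conditional_filter_eq_map_range] at h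
      exact h
    · intro y hy
      choose c hc using fun n => Submodule.mem_span_singleton.mp (y n).2
      funext n
      apply Subtype.ext
      have h1 : Tendsto (fun N => v.coord n (∑ i ∈ Finset.range N, (y i : V))) atTop
          (𝓝 (v.coord n x)) := ((v.coord n).continuous.tendsto x).comp hy
      have h2 : Tendsto (fun N => v.coord n (∑ i ∈ Finset.range N, (y i : V))) atTop
          (𝓝 (c n)) := by
        refine tendsto_const_nhds.congr' ?_
        filter_upwards [eventually_gt_atTop n] with N hN
        simp [← hc, v.ortho, Pi.single_apply, hN]
      have h3 := tendsto_nhds_unique h1 h2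
      simp only [h3, hc]

/-- A basis is normalized if all its vectors have norm `1`. -/
def IsNormalized (v : SchauderBasis ℝ V) : Prop := ∀ n, ‖v n‖ = 1

/-- A basis is `1`-unconditional if changing signs of coefficients does not increase the norm. -/
def IsOneUnconditional (v : SchauderBasis ℝ V) : Prop :=
  ∀ (a s : ℕ → ℝ), (∀ n, s n = 1 ∨ s n = -1) → ∀ k : ℕ,
    ‖∑ n ∈ Finset.range k, (s n * a n) • v n‖ ≤ ‖∑ n ∈ Finset.range k, a n • v n‖

end SchauderBasis

/-- The sequence `e 0, e 1, …` is `C`-dominated by `f 0, f 1, …`, both of length `N`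
(infinite sequences if `N = ⊤`). -/
def IsDominatedBy {X Y : Type*} [NormedAddCommGroup X] [NormedSpace ℝ X]
    [NormedAddCommGroup Y] [NormedSpace ℝ Y] (N : ℕ∞) (C : ℝ) (e : ℕ → X) (f : ℕ → Y) : Prop :=
  ∀ (k : ℕ), (k : ℕ∞) ≤ N → ∀ a : ℕ → ℝ,
    ‖∑ n ∈ Finset.range k, a n • e n‖ ≤ C * ‖∑ n ∈ Finset.range k, a n • f n‖

/-- The FDD `E` of `Z` satisfies subsequential `V`-upper block estimates in `Z`: there is a constant
`C ≥ 1` such that every (finite or infinite) normalized block sequence `(zₙ)` is `C`-dominated by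
`(v_{mₙ})`, where `mₙ = min supp zₙ`. -/
def FDD.SatisfiesUpperBlockEstimates {Z V : Type*} [NormedAddCommGroup Z] [NormedSpace ℝ Z]
    [NormedAddCommGroup V] [NormedSpace ℝ V] (E : FDD Z) (v : SchauderBasis ℝ V) : Prop :=
  ∃ C : ℝ, 1 ≤ C ∧ ∀ (N : ℕ∞) (z : ℕ → Z), E.IsBlockSequence N z →
    (∀ n : ℕ, (n : ℕ∞) < N → ‖z n‖ = 1) →
    IsDominatedBy N C z (fun n => v (sInf (E.supp (z n))))

/-! ### The Szlenk index -/

section Szlenk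

variable {X : Type*} [NormedAddCommGroup X] [NormedSpace ℝ X]

/-- The derived set `(K)'_ε`: those points of `K` all of whose weak* neighbourhoods `U` satisfy
`diam (U ∩ K) > ε`, with the diameter taken in the norm of the dual. -/
def szlenkDerivative (K : Set (WeakDual ℝ X)) (ε : ℝ) : Set (WeakDual ℝ X) :=
  {z ∈ K | ∀ U ∈ 𝓝 z, ENNReal.ofReal ε < Metric.ediam (WeakDual.toStrongDual '' (U ∩ K))}

/-- The iterated derived sets `P_α(K, ε)`. -/
def szlenkDerived (K : Set (WeakDual ℝ X)) (ε : ℝ) (α : Ordinal.{0}) : Set (WeakDual ℝ X) :=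
  Ordinal.limitRecOn α K (fun _ P => szlenkDerivative P ε) (fun α _ P => ⋂ β : Set.Iio α, P β β.2)

open Classical in
/-- `η(K, ε)`: the least countable ordinal `α` with `P_α(K, ε) = ∅` if there is one,
and `ω₁` otherwise. -/
def szlenkEta (K : Set (WeakDual ℝ X)) (ε : ℝ) : Ordinal.{0} :=
  if ∃ α < Ordinal.omega 1, szlenkDerived K ε α = ∅ then sInf {α | szlenkDerived K ε α = ∅}
  else Ordinal.omega 1

variable (X) in
/-- The closed unit ball of the dual, as a subset of the dual with its weak* topology. -/
def dualUnitBall : Set (WeakDual ℝ X) :=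
  {x | ‖WeakDual.toStrongDual x‖ ≤ 1}

variable (X) in
/-- The Szlenk index of `X`: the supremum of `η(B_{X*}, ε)` over all `ε > 0` (all these ordinals
are at most `ω₁`). -/
def szlenkIndex : Ordinal.{0} :=
  ⨆ ε : {ε : ℝ // 0 < ε}, szlenkEta (dualUnitBall X) ε

end Szlenk

end

/-! The inequality is proved for each `ε` separately: if `P_α(B_{Z*}, ε)` is non-empty, then so is
`P_α(B_{V*}, ε / (16 C))`, where `C` is the constant of the upper block estimates.

A functional `z` on `Z` and a finite normalized block sequence `x₀, …, x_{k-1}` give the functional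
`C⁻¹ ∑ z(xᵢ) v*_{mᵢ}` on `V`, where `mᵢ = min supp xᵢ` (`blockTransfer`). The upper estimates,
together with the contractivity of the coordinate projections of a `1`-unconditional basis, say that
it lies in `B_{V*}` if `z ∈ B_{Z*}` (`blockTransfer_mem_dualUnitBall`). By induction on `α` it lies
in `P_α(B_{V*}, ε / (16 C))` if `z ∈ P_α(B_{Z*}, ε)` (`blockTransfer_mem_szlenkDerived`); it is
essential that this is claimed for all block sequences at once. In the successor step, `z` is a weak*
limit of functionals `z'` of the previous derived set with `‖z' - z‖ > ε / 2`. Such a `z'` is weak*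
close to `z`, hence close to it on any given initial part of the decomposition, so `z' - z` exceeds
`ε / 8` at a normalized vector `t` supported far to the right (`FDD.eventually_exists_mem_tail`).
Since the decomposition is shrinking, `z` itself is small there (`FDD.IsShrinking.exists_tail_le`),
so `|z'(t)| > ε / 16`. Appending `t` to the block sequence produces a functional of the previous
derived set of `B_{V*}` that differs from the old one in norm by more than `ε / (16 C)`, and it is
weak* close to it because the coordinate functionals of a normalized basis are weak* null.

The empty block sequence then shows that the derived sets of `B_{Z*}` become empty no later than
those of `B_{V*}`. -/

/-! ### Coordinates and tails of a finite dimensional decomposition -/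

/-- Modulo a closed subspace of finite codimension, the unit ball is totally bounded. -/
theorem exists_finite_approx_mod_of_finiteDimensional_quotient {Z : Type*} [NormedAddCommGroup Z]
    [NormedSpace ℝ Z] {S : Submodule ℝ Z} (hS : IsClosed (S : Set Z))
    [FiniteDimensional ℝ (Z ⧸ S)] {δ : ℝ} (hδ : 0 < δ) :
    ∃ F : Set Z, F.Finite ∧ (∀ f ∈ F, ‖f‖ ≤ 1) ∧
      ∀ z : Z, ‖z‖ ≤ 1 → ∃ f ∈ F, ∃ r, z - f - r ∈ S ∧ ‖r‖ < δ := by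
  have : ProperSpace (Z ⧸ S) := FiniteDimensional.proper ℝ _
  have htb : TotallyBounded ((Submodule.Quotient.mk : Z → Z ⧸ S) '' Metric.closedBall 0 1) := by
    refine (isCompact_closedBall (0 : Z ⧸ S) 1).totallyBounded.subset ?_
    rintro _ ⟨z, hz, rfl⟩
    rw [mem_closedBall_zero_iff] at hz ⊢
    exact (Submodule.Quotient.norm_mk_le _ z).trans hz
  obtain ⟨t, hts, htf, htc⟩ := htb.exists_subset (Metric.dist_mem_uniformity hδ)
  have hlift : ∀ q ∈ t, ∃ f : Z, ‖f‖ ≤ 1 ∧ Submodule.Quotient.mk f = q := fun q hq => by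
    obtain ⟨f, hf, hfq⟩ := hts hq
    exact ⟨f, mem_closedBall_zero_iff.mp hf, hfq⟩
  choose! g hg hgt using hlift
  refine ⟨g '' t, htf.image g, ?_, fun z hz => ?_⟩
  · rintro _ ⟨q, hq, rfl⟩
    exact hg q hq
  obtain ⟨q, hq, hzq⟩ := Set.mem_iUnion₂.mp
    (htc (Set.mem_image_of_mem _ (mem_closedBall_zero_iff.mpr hz)))
  have hzf : ‖(Submodule.Quotient.mk (z - g q) : Z ⧸ S)‖ < δ := by
    rw [Submodule.Quotient.mk_sub, hgt q hq, ← dist_eq_norm]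
    exact hzq
  obtain ⟨r, hr, hrδ⟩ := QuotientAddGroup.norm_lt_iff.mp hzf
  exact ⟨g q, Set.mem_image_of_mem g hq, r, (Submodule.Quotient.eq S).mp hr.symm, hrδ⟩

namespace FDD

variable {Z : Type*} [NormedAddCommGroup Z] [NormedSpace ℝ Z]

theorem coord_eq_of_tendsto (E : FDD Z) {z : Z} {x : (n : ℕ) → E.space n}
    (h : Tendsto (fun N => ∑ n ∈ Finset.range N, (x n : Z)) atTop (𝓝 z)) (n : ℕ) :
    E.coord n z = x n :=
  congrFun ((E.existsUnique_expansion z).unique (E.tendsto_coord z) h) n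

theorem coord_add (E : FDD Z) (n : ℕ) (x y : Z) :
    E.coord n (x + y) = E.coord n x + E.coord n y := by
  refine E.coord_eq_of_tendsto (x := fun n => E.coord n x + E.coord n y) ?_ n
  simpa [Finset.sum_add_distrib] using (E.tendsto_coord x).add (E.tendsto_coord y)

theorem coord_smul (E : FDD Z) (n : ℕ) (c : ℝ) (x : Z) :
    E.coord n (c • x) = c • E.coord n x := by
  refine E.coord_eq_of_tendsto (x := fun n => c • E.coord n x) ?_ n
  simpa [Finset.smul_sum] using (E.tendsto_coord x).const_smul c

theorem coord_zero (E : FDD Z) (n : ℕ) : E.coord n 0 = 0 := by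
  simpa using E.coord_smul n 0 0

theorem coord_of_mem_space (E : FDD Z) {n m : ℕ} (x : E.space m) (h : n ≠ m) :
    E.coord n (x : Z) = 0 := by
  have := E.coord_eq_of_tendsto (z := (x : Z)) (x := Pi.single m x) ?_ n
  · rw [this, Pi.single_eq_of_ne h]
  · refine tendsto_const_nhds.congr' ?_
    filter_upwards [eventually_gt_atTop m] with N hN
    rw [Finset.sum_eq_single m]
    · simp
    · intro b _ hb
      simp [Pi.single_eq_of_ne hb]
    · intro hm
      exact absurd (Finset.mem_range.mpr hN) hm

theorem supp_nonempty (E : FDD Z) {z : Z} (hz : z ≠ 0) : (E.supp z).Nonempty := by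
  by_contra h
  have h0 : ∀ n, E.coord n z = 0 := fun n => by
    by_contra hn
    exact h ⟨n, hn⟩
  have := E.tendsto_coord z
  simp only [h0, ZeroMemClass.coe_zero, Finset.sum_const_zero] at this
  exact hz (tendsto_nhds_unique tendsto_const_nhds this).symm

/-- The finitely supported vectors whose support lies in `[N, ∞)`. No closure is taken, so that
every non-zero element may be used as a term of a block sequence. -/
def tail (E : FDD Z) (N : ℕ) : Submodule ℝ Z where
  carrier := {z | (E.supp z).Finite ∧ ∀ n < N, E.coord n z = 0}
  add_mem' {x y} hx hy := by
    refine ⟨(hx.1.union hy.1).subset fun n hn => ?_, fun n hn => ?_⟩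
    · by_contra h
      simp only [supp, Set.mem_union, Set.mem_ofPred_eq, not_or, not_not] at h
      exact hn (by rw [coord_add, h.1, h.2, add_zero])
    · rw [coord_add, hx.2 n hn, hy.2 n hn, add_zero]
  zero_mem' := by
    refine ⟨?_, fun n _ => E.coord_zero n⟩
    simp [supp, coord_zero]
  smul_mem' c x hx := by
    refine ⟨hx.1.subset fun n hn h => hn ?_, fun n hn => ?_⟩
    · rw [coord_smul, h, smul_zero]
    · rw [coord_smul, hx.2 n hn, smul_zero]

theorem le_of_mem_tail (E : FDD Z) {N n : ℕ} {z : Z} (hz : z ∈ E.tail N) (hn : n ∈ E.supp z) :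
    N ≤ n := by
  by_contra! h
  exact hn (hz.2 n h)

theorem tail_anti (E : FDD Z) {M N : ℕ} (h : M ≤ N) : E.tail N ≤ E.tail M :=
  fun _ hz => ⟨hz.1, fun n hn => hz.2 n (hn.trans_le h)⟩

theorem space_le_tail (E : FDD Z) {n N : ℕ} (h : N ≤ n) : E.space n ≤ E.tail N := by
  intro x hx
  refine ⟨(Set.finite_singleton n).subset fun m hm => ?_, fun m hm => ?_⟩
  · by_contra hmn
    exact hm (E.coord_of_mem_space ⟨x, hx⟩ hmn)
  · exact E.coord_of_mem_space ⟨x, hx⟩ (by lia)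

theorem sub_sum_mem_closure_tail (E : FDD Z) (N : ℕ) (z : Z) :
    z - ∑ n ∈ Finset.range N, (E.coord n z : Z) ∈ closure (E.tail N : Set Z) := by
  refine mem_closure_of_tendsto ((E.tendsto_coord z).sub_const _) ?_
  filter_upwards [eventually_ge_atTop N] with M hM
  rw [← Finset.sum_range_add_sum_Ico _ hM, add_sub_cancel_left]
  exact Submodule.sum_mem _ fun n hn => E.space_le_tail (Finset.mem_Ico.mp hn).1 (E.coord n z).2

/-- The closure of a tail has finite codimension: modulo it, a vector equals a partial sum of its
expansion. -/
theorem finiteDimensional_quotient_tail (E : FDD Z) (N : ℕ) :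
    FiniteDimensional ℝ (Z ⧸ (E.tail N).topologicalClosure) := by
  have := E.finiteDimensional
  let f : ((n : Fin N) → E.space n) →ₗ[ℝ] Z :=
    ∑ n : Fin N, (E.space n).subtype ∘ₗ LinearMap.proj n
  refine Module.Finite.of_surjective ((E.tail N).topologicalClosure.mkQ ∘ₗ f) fun q => ?_
  obtain ⟨z, rfl⟩ := Submodule.mkQ_surjective _ q
  refine ⟨fun n => E.coord n z, ?_⟩
  have hf : f (fun n => E.coord n z) = ∑ n ∈ Finset.range N, (E.coord n z : Z) := by
    simp [f, Finset.sum_range]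
  rw [LinearMap.comp_apply, hf, eq_comm, ← sub_eq_zero, ← map_sub, Submodule.mkQ_apply,
    Submodule.Quotient.mk_eq_zero]
  exact E.sub_sum_mem_closure_tail N z

/-- Up to `δ`, the unit ball is contained in the sum of a finite subset of the unit ball and a
tail. This replaces the uniform boundedness of the partial sum projections. -/
theorem exists_finite_approx_mod_tail (E : FDD Z) (N : ℕ) {δ : ℝ} (hδ : 0 < δ) :
    ∃ F : Set Z, F.Finite ∧ (∀ f ∈ F, ‖f‖ ≤ 1) ∧
      ∀ z : Z, ‖z‖ ≤ 1 → ∃ f ∈ F, ∃ t ∈ E.tail N, ‖z - f - t‖ < δ := by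
  have := E.finiteDimensional_quotient_tail N
  obtain ⟨F, hFf, hF, hFz⟩ := exists_finite_approx_mod_of_finiteDimensional_quotient
    (E.tail N).isClosed_topologicalClosure hδ
  refine ⟨F, hFf, hF, fun z hz => ?_⟩
  obtain ⟨f, hf, r, hmem, hrδ⟩ := hFz z hz
  obtain ⟨t, ht, hdt⟩ := Metric.mem_closure_iff.mp hmem (δ - ‖r‖) (by linarith)
  refine ⟨f, hf, t, ht, ?_⟩
  rw [dist_eq_norm] at hdt
  have := norm_add_le (z - f - r - t) r
  rw [show z - f - r - t + r = z - f - t by abel] at this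
  linarith

/-- For a shrinking decomposition every functional is small on late tails, since the functionals in
the span of the duals of the `E n` vanish on a tail. -/
theorem IsShrinking.exists_tail_le {E : FDD Z} (hE : E.IsShrinking) (g : StrongDual ℝ Z) {η : ℝ}
    (hη : 0 < η) : ∃ N, ∀ t ∈ E.tail N, |g t| ≤ η * ‖t‖ := by
  have hg : g ∈ closure (E.finiteDual : Set (StrongDual ℝ Z)) := by
    have : g ∈ E.finiteDual.topologicalClosure := by rw [hE]; trivial
    exact this
  obtain ⟨h, hh, hgh⟩ := Metric.mem_closure_iff.mp hg η hη
  have hN : ∃ N, ∀ t ∈ E.tail N, h t = 0 := by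
    clear hgh
    induction hh using Submodule.span_induction with
    | mem x hx =>
      obtain ⟨n, f, hf⟩ := hx
      exact ⟨n + 1, fun t ht => by rw [hf, ht.2 n n.lt_succ_self, map_zero]⟩
    | zero => exact ⟨0, fun _ _ => rfl⟩
    | add x y _ _ hx hy =>
      obtain ⟨N, hN⟩ := hx
      obtain ⟨M, hM⟩ := hy
      exact ⟨max N M, fun t ht => by
        simp [hN t (E.tail_anti (le_max_left _ _) ht), hM t (E.tail_anti (le_max_right _ _) ht)]⟩
    | smul a x _ hx =>
      obtain ⟨N, hN⟩ := hx
      exact ⟨N, fun t ht => by simp [hN t ht]⟩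
  obtain ⟨N, hN⟩ := hN
  refine ⟨N, fun t ht => ?_⟩
  have := (g - h).le_opNorm t
  rw [sub_apply, hN t ht, sub_zero, Real.norm_eq_abs] at this
  rw [dist_eq_norm] at hgh
  exact this.trans (by gcongr)

/-- Functionals of the unit ball that are weak* close and far apart in norm are already far
apart on any given tail. The constant `ε / 8` does not depend on the tail. -/
theorem eventually_exists_mem_tail (E : FDD Z) (N : ℕ) {ε : ℝ} (hε : 0 < ε)
    {z : WeakDual ℝ Z} (hz : z ∈ dualUnitBall Z) :
    ∀ᶠ z' in 𝓝 z, z' ∈ dualUnitBall Z →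
      ε / 2 < ‖WeakDual.toStrongDual z' - WeakDual.toStrongDual z‖ →
      ∃ t ∈ E.tail N, ‖t‖ = 1 ∧ ε / 8 < |z' t - z t| := by
  set δ : ℝ := min 1 (ε / 24)
  have hδ0 : 0 < δ := by positivity
  have hδ1 : δ ≤ 1 := min_le_left _ _
  have hδ2 : δ ≤ ε / 24 := min_le_right _ _
  obtain ⟨F, hF, hF1, hFt⟩ := E.exists_finite_approx_mod_tail N hδ0
  have hev : ∀ᶠ z' in 𝓝 z, ∀ f ∈ F, |z' f - z f| < δ := by
    refine (eventually_all_finite hF).mpr fun f _ => ?_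
    have := (WeakDual.eval_continuous (𝕜 := ℝ) f).tendsto z
    exact Metric.tendsto_nhds.mp this δ hδ0
  filter_upwards [hev] with z' hz'F hz' hnorm
  by_contra! hcon
  set y := WeakDual.toStrongDual z' - WeakDual.toStrongDual z with hy
  have hyx : ∀ x, y x = z' x - z x := fun x => rfl
  have hy2 : ‖y‖ ≤ 2 := (norm_sub_le _ _).trans (by
    have h1 : ‖WeakDual.toStrongDual z'‖ ≤ 1 := hz'
    have h2 : ‖WeakDual.toStrongDual z‖ ≤ 1 := hz
    linarith)
  have htail : ∀ t ∈ E.tail N, |y t| ≤ ε / 8 * ‖t‖ := by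
    intro t ht
    rcases eq_or_ne t 0 with rfl | h0
    · simp
    have hpos : 0 < ‖t‖ := norm_pos_iff.mpr h0
    have := hcon (‖t‖⁻¹ • t) (Submodule.smul_mem _ _ ht)
      (by rw [norm_smul, norm_inv, norm_norm, inv_mul_cancel₀ hpos.ne'])
    rw [← hyx, map_smul, smul_eq_mul, abs_mul, abs_inv, abs_norm, inv_mul_le_iff₀ hpos] at this
    linarith
  refine absurd hnorm (not_lt.mpr ?_)
  -- A unit vector is `f + t` up to `δ`, with `f ∈ F` and `‖t‖ ≤ 3`, so that
  -- `‖y‖ ≤ δ + 3 * (ε / 8) + 2 * δ ≤ ε / 2`.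
  refine ContinuousLinearMap.opNorm_le_of_unit_norm (by positivity) fun x hx => ?_
  obtain ⟨f, hf, t, ht, hft⟩ := hFt x hx.le
  have h1 : ‖t‖ ≤ 3 := by
    have : t = x - f - (x - f - t) := by abel
    rw [this]
    have := norm_sub_le (x - f) (x - f - t)
    have := norm_sub_le x f
    have := hF1 f hf
    linarith
  have h2 : |y f| ≤ δ := (hyx f ▸ hz'F f hf).le
  have h3 := htail t ht
  have h4 : |y (x - f - t)| ≤ 2 * δ := (y.le_opNorm _).trans (by gcongr)
  have h5 : y x = y f + y t + y (x - f - t) := by rw [← map_add, ← map_add]; congr 1; abel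
  rw [h5, Real.norm_eq_abs]
  have h6 := abs_add_three (y f) (y t) (y (x - f - t))
  have h7 : ε / 8 * ‖t‖ ≤ ε / 8 * 3 := by gcongr
  linarith

theorem IsBlockSequence.sInf_mem {E : FDD Z} {N : ℕ∞} {x : ℕ → Z} (hx : E.IsBlockSequence N x)
    {i : ℕ} (hi : (i : ℕ∞) < N) : sInf (E.supp (x i)) ∈ E.supp (x i) :=
  Nat.sInf_mem (E.supp_nonempty (hx.ne_zero i hi))

theorem IsBlockSequence.sInf_supp_lt {E : FDD Z} {k : ℕ} {x : ℕ → Z} (hx : E.IsBlockSequence k x)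
    {i j : ℕ} (hij : i < j) (hj : j < k) : sInf (E.supp (x i)) < sInf (E.supp (x j)) := by
  have step : ∀ n, n + 1 < k → sInf (E.supp (x n)) < sInf (E.supp (x (n + 1))) := fun n hn =>
    hx.lt n (by exact_mod_cast hn) _ (hx.sInf_mem (by exact_mod_cast (by lia : n < k)))
      _ (hx.sInf_mem (by exact_mod_cast hn))
  induction j, hij using Nat.le_induction with
  | base => exact step i hj
  | succ j hij ih => exact (ih (by lia)).trans (step j hj)

/-- A block sequence is extended by a vector supported to the right of all its terms. -/
theorem IsBlockSequence.update {E : FDD Z} {k : ℕ} {x : ℕ → Z} (hx : E.IsBlockSequence k x)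
    {N : ℕ} (hN : ∀ i < k, ∀ n ∈ E.supp (x i), n < N) {t : Z} (ht : t ∈ E.tail N) (h0 : t ≠ 0) :
    E.IsBlockSequence (k + 1 : ℕ) (Function.update x k t) := by
  have hne : ∀ n < k, Function.update x k t n = x n := fun n hn =>
    Function.update_of_ne hn.ne _ _
  refine ⟨fun n hn => ?_, fun n hn => ?_, fun n hn => ?_⟩
  · rcases (Nat.lt_succ_iff.mp (by exact_mod_cast hn) : n ≤ k).lt_or_eq with h | rfl
    · rw [hne n h]
      exact hx.ne_zero n (by exact_mod_cast h)
    · simpa using h0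
  · rcases (Nat.lt_succ_iff.mp (by exact_mod_cast hn) : n ≤ k).lt_or_eq with h | rfl
    · rw [hne n h]
      exact hx.finite_supp n (by exact_mod_cast h)
    · simpa using ht.1
  · have hn' : n < k := by
      have : n + 1 < k + 1 := by exact_mod_cast hn
      lia
    rw [hne n hn']
    rcases (Nat.succ_le_of_lt hn').lt_or_eq with h | h
    · rw [hne (n + 1) h]
      exact hx.lt n (by exact_mod_cast h)
    · rw [show n + 1 = k from h, Function.update_self]
      exact fun i hi j hj => (hN n hn' i hi).trans_le (E.le_of_mem_tail ht hj)

end FDD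

/-! ### Coordinate functionals of a `1`-unconditional basis -/

namespace SchauderBasis

variable {V : Type*} [NormedAddCommGroup V] [NormedSpace ℝ V]

theorem tendsto_partialSum (v : SchauderBasis ℝ V) (y : V) :
    Tendsto (fun N => ∑ n ∈ Finset.range N, v.coord n y • v n) atTop (𝓝 y) := by
  have h := v.expansion y
  rwa [HasSum, SummationFilter.conditional_filter_eq_map_range] at h

theorem IsNormalized.tendsto_coord {v : SchauderBasis ℝ V} (hv : v.IsNormalized) (y : V) :
    Tendsto (fun n => v.coord n y) atTop (𝓝 0) := by
  have h := (v.tendsto_partialSum y).comp (tendsto_add_atTop_nat 1)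
  have h' := (h.sub (v.tendsto_partialSum y)).norm
  simp only [Function.comp_apply, Finset.sum_range_succ, add_sub_cancel_left, norm_smul, hv _,
    mul_one, sub_self, norm_zero] at h'
  exact tendsto_zero_iff_norm_tendsto_zero.mpr h'

/-- The coordinate functionals are weak* null, uniformly for bounded coefficients. -/
theorem IsNormalized.tendsto_smul_coord {v : SchauderBasis ℝ V} (hv : v.IsNormalized) :
    Tendsto (fun p : ℝ × ℕ => StrongDual.toWeakDual (p.1 • v.coord p.2))
      (𝓟 (Set.Icc (-1) 1) ×ˢ atTop) (𝓝 0) := by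
  refine tendsto_iff_forall_eval_tendsto_topDualPairing.mpr fun y => ?_
  refine bdd_le_mul_tendsto_zero' (f := fun p : ℝ × ℕ => p.1) (g := fun p => v.coord p.2 y) 1 ?_
    ((hv.tendsto_coord y).comp tendsto_snd)
  refine tendsto_fst.eventually (p := fun r : ℝ => |r| ≤ 1) ?_
  exact eventually_principal.mpr fun r hr => abs_le.mpr hr

theorem IsOneUnconditional.norm_sum_subset_le {v : SchauderBasis ℝ V} (hv : v.IsOneUnconditional)
    (a : ℕ → ℝ) {S : Finset ℕ} {M : ℕ} (hS : S ⊆ Finset.range M) :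
    ‖∑ n ∈ S, a n • v n‖ ≤ ‖∑ n ∈ Finset.range M, a n • v n‖ := by
  -- The coordinate projection is the average of the identity and a change of signs.
  have h := hv a (fun n => if n ∈ S then 1 else -1) (fun n => by
    by_cases h : n ∈ S <;> simp [h]) M
  have h2 : (2 : ℝ) • ∑ n ∈ S, a n • v n = ∑ n ∈ Finset.range M, a n • v n +
      ∑ n ∈ Finset.range M, ((if n ∈ S then 1 else -1) * a n) • v n := by
    rw [← Finset.sum_add_distrib, Finset.smul_sum]
    refine Finset.sum_subset_zero_on_sdiff hS (fun n hn => ?_) (fun n hn => ?_)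
    · simp [(Finset.mem_sdiff.mp hn).2]
    · simp [hn, two_smul]
  have h3 : ‖(2 : ℝ) • ∑ n ∈ S, a n • v n‖ = 2 * ‖∑ n ∈ S, a n • v n‖ := by
    rw [norm_smul]; norm_num
  have h4 := norm_add_le (∑ n ∈ Finset.range M, a n • v n)
    (∑ n ∈ Finset.range M, ((if n ∈ S then (1 : ℝ) else -1) * a n) • v n)
  rw [← h2, h3] at h4
  linarith

theorem IsOneUnconditional.norm_sum_coord_le {v : SchauderBasis ℝ V} (hv : v.IsOneUnconditional)
    (S : Finset ℕ) (y : V) : ‖∑ n ∈ S, v.coord n y • v n‖ ≤ ‖y‖ := by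
  refine ge_of_tendsto (v.tendsto_partialSum y).norm ?_
  obtain ⟨M, hM⟩ := S.exists_nat_subset_range
  filter_upwards [eventually_ge_atTop M] with M' hM'
  exact hv.norm_sum_subset_le _ (hM.trans (Finset.range_subset_range.mpr hM'))

end SchauderBasis

/-! ### Derived sets -/

section Derived

variable {X : Type*} [NormedAddCommGroup X] [NormedSpace ℝ X]

theorem szlenkDerived_zero (K : Set (WeakDual ℝ X)) (ε : ℝ) : szlenkDerived K ε 0 = K :=
  Ordinal.limitRecOn_zero ..

theorem szlenkDerived_add_one (K : Set (WeakDual ℝ X)) (ε : ℝ) (α : Ordinal.{0}) :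
    szlenkDerived K ε (α + 1) = szlenkDerivative (szlenkDerived K ε α) ε :=
  Ordinal.limitRecOn_add_one ..

theorem szlenkDerived_limit (K : Set (WeakDual ℝ X)) (ε : ℝ) {α : Ordinal.{0}}
    (hα : Order.IsSuccLimit α) :
    szlenkDerived K ε α = ⋂ β : Set.Iio α, szlenkDerived K ε β :=
  Ordinal.limitRecOn_limit _ _ _ _ hα

theorem szlenkDerived_subset (K : Set (WeakDual ℝ X)) (ε : ℝ) (α : Ordinal.{0}) :
    szlenkDerived K ε α ⊆ K := by
  induction α using Ordinal.limitRecOn with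
  | zero => rw [szlenkDerived_zero]
  | add_one α ih =>
    rw [szlenkDerived_add_one]
    exact fun z hz => ih hz.1
  | limit α hα ih =>
    rw [szlenkDerived_limit K ε hα]
    exact (Set.iInter_subset _ ⟨0, hα.bot_lt⟩).trans (ih 0 hα.bot_lt)

theorem exists_norm_sub_of_mem_szlenkDerivative {K : Set (WeakDual ℝ X)} {ε : ℝ}
    {z : WeakDual ℝ X} (hz : z ∈ szlenkDerivative K ε) {U : Set (WeakDual ℝ X)} (hU : U ∈ 𝓝 z) :
    ∃ z' ∈ U ∩ K, ε / 2 < ‖WeakDual.toStrongDual z' - WeakDual.toStrongDual z‖ := by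
  by_contra! hcon
  refine absurd (hz.2 U hU) (not_lt.mpr (Metric.ediam_le ?_))
  rintro _ ⟨a, ha, rfl⟩ _ ⟨b, hb, rfl⟩
  rw [edist_dist]
  refine ENNReal.ofReal_le_ofReal ?_
  have h1 := hcon a ha
  have h2 := hcon b hb
  rw [← dist_eq_norm] at h1 h2
  have := dist_triangle_right (WeakDual.toStrongDual a) (WeakDual.toStrongDual b)
    (WeakDual.toStrongDual z)
  linarith

theorem mem_szlenkDerivative_of_exists {K : Set (WeakDual ℝ X)} {ε : ℝ} {z : WeakDual ℝ X}
    (hε : 0 ≤ ε) (hz : z ∈ K)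
    (h : ∀ U ∈ 𝓝 z, ∃ z' ∈ U ∩ K, ε < ‖WeakDual.toStrongDual z' - WeakDual.toStrongDual z‖) :
    z ∈ szlenkDerivative K ε := by
  refine ⟨hz, fun U hU => ?_⟩
  obtain ⟨z', hz', hlt⟩ := h U hU
  refine lt_of_lt_of_le ?_ (Metric.edist_le_ediam_of_mem (Set.mem_image_of_mem _ hz')
    (Set.mem_image_of_mem _ ⟨mem_of_mem_nhds hU, hz⟩))
  rw [edist_dist, dist_eq_norm]
  exact (ENNReal.ofReal_lt_ofReal_iff (hε.trans_lt hlt)).mpr hlt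

theorem szlenkEta_le_omega_one (K : Set (WeakDual ℝ X)) (ε : ℝ) :
    szlenkEta K ε ≤ Ordinal.omega 1 := by
  unfold szlenkEta
  split_ifs with h
  · obtain ⟨α, hα, he⟩ := h
    exact (csInf_le' (s := {α | szlenkDerived K ε α = ∅}) he).trans hα.le
  · exact le_rfl

theorem szlenkEta_le_of_forall_eq_empty {Y : Type*} [NormedAddCommGroup Y] [NormedSpace ℝ Y]
    {K : Set (WeakDual ℝ X)} {L : Set (WeakDual ℝ Y)} {ε ε' : ℝ}
    (h : ∀ α, szlenkDerived L ε' α = ∅ → szlenkDerived K ε α = ∅) :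
    szlenkEta K ε ≤ szlenkEta L ε' := by
  by_cases hL : ∃ α < Ordinal.omega 1, szlenkDerived L ε' α = ∅
  · have hK : ∃ α < Ordinal.omega 1, szlenkDerived K ε α = ∅ :=
      hL.imp fun α hα => ⟨hα.1, h α hα.2⟩
    rw [szlenkEta, szlenkEta, if_pos hK, if_pos hL]
    obtain ⟨α, -, he⟩ := hL
    exact csInf_le_csInf' ⟨α, he⟩ h
  · rw [szlenkEta.eq_1 L, if_neg hL]
    exact szlenkEta_le_omega_one K ε

theorem szlenkEta_le_szlenkIndex {ε : ℝ} (hε : 0 < ε) :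
    szlenkEta (dualUnitBall X) ε ≤ szlenkIndex X :=
  le_ciSup (f := fun ε : {ε : ℝ // 0 < ε} => szlenkEta (dualUnitBall X) ε)
    ⟨Ordinal.omega 1, by rintro _ ⟨ε, rfl⟩; exact szlenkEta_le_omega_one _ _⟩ ⟨ε, hε⟩

end Derived

/-! ### Transferring functionals along block sequences -/

section Transfer

variable {V Z : Type*} [NormedAddCommGroup V] [NormedSpace ℝ V]
  [NormedAddCommGroup Z] [NormedSpace ℝ Z]

/-- The functional `c • ∑_{i < k} z(xᵢ) v*_{mᵢ}` on `V`, with `mᵢ = min supp xᵢ`, which records the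
values of the functional `z` on the block sequence `x`. -/
noncomputable def blockTransfer (v : SchauderBasis ℝ V) (E : FDD Z) (c : ℝ) (k : ℕ) (x : ℕ → Z)
    (z : WeakDual ℝ Z) : WeakDual ℝ V :=
  StrongDual.toWeakDual
    (∑ i ∈ Finset.range k, (c * z (x i)) • v.coord (sInf (E.supp (x i))))

theorem blockTransfer_apply (v : SchauderBasis ℝ V) (E : FDD Z) (c : ℝ) (k : ℕ) (x : ℕ → Z)
    (z : WeakDual ℝ Z) (y : V) : blockTransfer v E c k x z y =
      ∑ i ∈ Finset.range k, c * z (x i) * v.coord (sInf (E.supp (x i))) y := by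
  simp [blockTransfer, StrongDual.toWeakDual_apply, -map_sum, -map_smul]

theorem continuous_blockTransfer (v : SchauderBasis ℝ V) (E : FDD Z) (c : ℝ) (k : ℕ)
    (x : ℕ → Z) : Continuous (blockTransfer v E c k x) := by
  refine WeakDual.continuous_of_continuous_eval fun y => ?_
  simp only [blockTransfer_apply]
  refine continuous_finsetSum _ fun i _ => ?_
  exact (continuous_const.mul (WeakDual.eval_continuous (x i))).mul continuous_const

theorem blockTransfer_update (v : SchauderBasis ℝ V) (E : FDD Z) (c : ℝ) (k : ℕ) (x : ℕ → Z)
    (t : Z) (z : WeakDual ℝ Z) : blockTransfer v E c (k + 1) (Function.update x k t) z =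
      blockTransfer v E c k x z +
        StrongDual.toWeakDual ((c * z t) • v.coord (sInf (E.supp t))) := by
  rw [blockTransfer, Finset.sum_range_succ, Function.update_self, map_add, blockTransfer]
  congr 2
  refine Finset.sum_congr rfl fun i hi => ?_
  rw [Function.update_of_ne (Finset.mem_range.mp hi).ne]

/-- Dualizing the upper estimates: `C⁻¹ • ∑ z(xᵢ) v*_{mᵢ}` has norm at most `‖z‖`. -/
theorem blockTransfer_mem_dualUnitBall {v : SchauderBasis ℝ V} (hv : v.IsOneUnconditional)
    {E : FDD Z} {C : ℝ} (hC : 1 ≤ C) {k : ℕ} {x : ℕ → Z} (hx : E.IsBlockSequence k x)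
    (hdom : IsDominatedBy (k : ℕ∞) C x (fun n => v (sInf (E.supp (x n)))))
    {z : WeakDual ℝ Z} (hz : z ∈ dualUnitBall Z) :
    blockTransfer v E C⁻¹ k x z ∈ dualUnitBall V := by
  have hC0 : 0 < C := by linarith
  refine ContinuousLinearMap.opNorm_le_bound _ zero_le_one fun y => ?_
  change ‖blockTransfer v E C⁻¹ k x z y‖ ≤ _
  set m : ℕ → ℕ := fun i => sInf (E.supp (x i)) with hm
  have h1 : blockTransfer v E C⁻¹ k x z y =
      C⁻¹ * WeakDual.toStrongDual z (∑ i ∈ Finset.range k, v.coord (m i) y • x i) := by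
    rw [blockTransfer_apply, map_sum, Finset.mul_sum]
    refine Finset.sum_congr rfl fun i _ => ?_
    rw [map_smul, smul_eq_mul]
    change C⁻¹ * z (x i) * v.coord (m i) y = C⁻¹ * (v.coord (m i) y * z (x i))
    ring
  have h2 : ‖∑ i ∈ Finset.range k, v.coord (m i) y • v (m i)‖ ≤ ‖y‖ := by
    have hinj : Set.InjOn m (Finset.range k) := by
      intro i hi j hj hij
      have hi := Finset.mem_range.mp hi
      have hj := Finset.mem_range.mp hj
      rcases lt_trichotomy i j with h | h | h
      · exact absurd hij (hx.sInf_supp_lt h hj).ne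
      · exact h
      · exact absurd hij (hx.sInf_supp_lt h hi).ne'
    rw [← Finset.sum_image (f := fun n => v.coord n y • v n) hinj]
    exact hv.norm_sum_coord_le _ y
  have h3 := hdom k le_rfl (fun i => v.coord (m i) y)
  have h4 := (WeakDual.toStrongDual z).le_of_opNorm_le hz
    (∑ i ∈ Finset.range k, v.coord (m i) y • x i)
  rw [h1, norm_mul, norm_inv, Real.norm_of_nonneg hC0.le, inv_mul_le_iff₀ hC0]
  calc _ ≤ _ := h4
    _ ≤ C * ‖∑ i ∈ Finset.range k, v.coord (m i) y • v (m i)‖ := by rw [one_mul]; exact h3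
    _ ≤ C * (1 * ‖y‖) := by rw [one_mul]; gcongr

/-- Weak* perturbations of `z`, together with bounded multiples of late coordinate functionals, move
the transferred functional by little in the weak* topology. -/
theorem exists_nhds_blockTransfer_add_mem {v : SchauderBasis ℝ V} (hv : v.IsNormalized)
    (E : FDD Z) (c : ℝ) (k : ℕ) (x : ℕ → Z) (z : WeakDual ℝ Z) {U : Set (WeakDual ℝ V)}
    (hU : U ∈ 𝓝 (blockTransfer v E c k x z)) :
    ∃ A ∈ 𝓝 z, ∃ N, ∀ z' ∈ A, ∀ r : ℝ, |r| ≤ 1 → ∀ m ≥ N,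
      blockTransfer v E c k x z' + StrongDual.toWeakDual (r • v.coord m) ∈ U := by
  have hlim : Tendsto (fun p : WeakDual ℝ Z × (ℝ × ℕ) => blockTransfer v E c k x p.1 +
      StrongDual.toWeakDual (p.2.1 • v.coord p.2.2)) (𝓝 z ×ˢ (𝓟 (Set.Icc (-1) 1) ×ˢ atTop))
      (𝓝 (blockTransfer v E c k x z + 0)) :=
    (((continuous_blockTransfer v E c k x).tendsto z).comp tendsto_fst).add
      (hv.tendsto_smul_coord.comp tendsto_snd)
  rw [add_zero] at hlim
  obtain ⟨p, hp, q, hq, hpq⟩ := eventually_prod_iff.mp (hlim.eventually_mem hU)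
  obtain ⟨r, hr, s, hs, hrs⟩ := eventually_prod_iff.mp hq
  obtain ⟨N, hN⟩ := eventually_atTop.mp hs
  exact ⟨{z' | p z'}, hp, N, fun z' hz' a ha m hm =>
    hpq hz' (hrs (eventually_principal.mp hr a (abs_le.mp ha)) (hN m hm))⟩

/-- The basis vector with index `min supp t` sees only the term appended to the block sequence. -/
theorem abs_le_norm_blockTransfer_update_sub {v : SchauderBasis ℝ V} (hv : v.IsNormalized)
    {E : FDD Z} (c : ℝ) {k : ℕ} (x : ℕ → Z) (t : Z)
    (ht : ∀ i < k, sInf (E.supp t) ≠ sInf (E.supp (x i))) (z z₀ : WeakDual ℝ Z) :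
    |c * z t| ≤ ‖WeakDual.toStrongDual (blockTransfer v E c (k + 1) (Function.update x k t) z) -
      WeakDual.toStrongDual (blockTransfer v E c k x z₀)‖ := by
  have hvan : ∀ u : WeakDual ℝ Z, blockTransfer v E c k x u (v (sInf (E.supp t))) = 0 := fun u => by
    rw [blockTransfer_apply]
    refine Finset.sum_eq_zero fun i hi => ?_
    simp [v.ortho, (ht i (Finset.mem_range.mp hi)).symm]
  have hval : (WeakDual.toStrongDual
      (blockTransfer v E c (k + 1) (Function.update x k t) z) -
      WeakDual.toStrongDual (blockTransfer v E c k x z₀)) (v (sInf (E.supp t))) = c * z t := by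
    change blockTransfer v E c (k + 1) (Function.update x k t) z (v (sInf (E.supp t))) -
      blockTransfer v E c k x z₀ (v (sInf (E.supp t))) = _
    rw [blockTransfer_update, hvan z₀, sub_zero]
    change blockTransfer v E c k x z (v (sInf (E.supp t))) +
      (c * z t) * v.coord (sInf (E.supp t)) (v (sInf (E.supp t))) = _
    simp [hvan z, v.ortho]
  have hle := ContinuousLinearMap.le_opNorm (WeakDual.toStrongDual
      (blockTransfer v E c (k + 1) (Function.update x k t) z) -
      WeakDual.toStrongDual (blockTransfer v E c k x z₀)) (v (sInf (E.supp t)))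
  rwa [hval, hv, mul_one, Real.norm_eq_abs] at hle

/-- The transferred functionals inherit membership in the derived sets: a functional that is weak*
close to `z` and far from it in norm is large on a vector `t` of a late tail, and appending `t` to
the block sequence gives a functional on `V` that is weak* close to the one of `z` and far from it
in norm. -/
theorem blockTransfer_mem_szlenkDerived {v : SchauderBasis ℝ V} (hv_norm : v.IsNormalized)
    (hv_unc : v.IsOneUnconditional) {E : FDD Z} (hE_shr : E.IsShrinking) {C : ℝ} (hC : 1 ≤ C)
    (hE : ∀ (N : ℕ∞) (z : ℕ → Z), E.IsBlockSequence N z → (∀ n : ℕ, (n : ℕ∞) < N → ‖z n‖ = 1) →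
      IsDominatedBy N C z (fun n => v (sInf (E.supp (z n)))))
    {ε : ℝ} (hε : 0 < ε) (α : Ordinal.{0}) :
    ∀ z ∈ szlenkDerived (dualUnitBall Z) ε α, ∀ (k : ℕ) (x : ℕ → Z), E.IsBlockSequence k x →
      (∀ n < k, ‖x n‖ = 1) →
      blockTransfer v E C⁻¹ k x z ∈ szlenkDerived (dualUnitBall V) (C⁻¹ * (ε / 16)) α := by
  have hC0 : 0 < C⁻¹ := inv_pos.mpr (by linarith)
  have hC1 : C⁻¹ ≤ 1 := inv_le_one_of_one_le₀ hC
  induction α using Ordinal.limitRecOn with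
  | zero =>
    intro z hz k x hx hx1
    rw [szlenkDerived_zero] at hz ⊢
    exact blockTransfer_mem_dualUnitBall hv_unc hC hx
      (hE k x hx fun n hn => hx1 n (by exact_mod_cast hn)) hz
  | limit α hα ih =>
    intro z hz k x hx hx1
    rw [szlenkDerived_limit _ _ hα] at hz ⊢
    exact Set.mem_iInter.mpr fun β => ih β β.2 z (Set.mem_iInter.mp hz β) k x hx hx1
  | add_one α ih =>
    intro z hz k x hx hx1
    rw [szlenkDerived_add_one] at hz ⊢
    have hzB : z ∈ dualUnitBall Z := szlenkDerived_subset _ _ _ hz.1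
    refine mem_szlenkDerivative_of_exists (by positivity) (ih z hz.1 k x hx hx1) fun U hU => ?_
    obtain ⟨A, hA, N₁, hAU⟩ := exists_nhds_blockTransfer_add_mem hv_norm E C⁻¹ k x z hU
    obtain ⟨N₂, hN₂⟩ := hE_shr.exists_tail_le (WeakDual.toStrongDual z)
      (η := ε / 16) (by positivity)
    obtain ⟨N₃, hN₃⟩ : ∃ N, ∀ i < k, ∀ n ∈ E.supp (x i), n < N := by
      have hfin : (⋃ i ∈ Set.Iio k, E.supp (x i)).Finite :=
        (Set.finite_Iio k).biUnion fun i hi => hx.finite_supp i (by exact_mod_cast hi)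
      obtain ⟨N, hN⟩ := hfin.bddAbove
      exact ⟨N + 1, fun i hi n hn => Nat.lt_succ_of_le (hN (Set.mem_biUnion hi hn))⟩
    set N := max N₁ (max N₂ N₃)
    have hN1 : N₁ ≤ N := le_max_left _ _
    have hN2 : N₂ ≤ N := (le_max_left _ _).trans (le_max_right _ _)
    have hN3 : N₃ ≤ N := (le_max_right _ _).trans (le_max_right _ _)
    obtain ⟨z', ⟨⟨hz'A, hz't⟩, hz'⟩, hdist⟩ := exists_norm_sub_of_mem_szlenkDerivative hz
      (inter_mem hA (E.eventually_exists_mem_tail N hε hzB))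
    have hz'B : z' ∈ dualUnitBall Z := szlenkDerived_subset _ _ _ hz'
    obtain ⟨t, ht, ht1, hlt⟩ := hz't hz'B hdist
    have ht0 : t ≠ 0 := norm_ne_zero_iff.mp (by rw [ht1]; exact one_ne_zero)
    have hzt : |z t| ≤ ε / 16 := by
      have := hN₂ t (E.tail_anti hN2 ht)
      rwa [ht1, mul_one] at this
    have hz'tl : ε / 16 < |z' t| := by
      have := abs_sub (z' t) (z t)
      linarith
    have hz'tu : |z' t| ≤ 1 := by
      simpa [ht1] using (WeakDual.toStrongDual z').le_of_opNorm_le hz'B t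
    set m := sInf (E.supp t) with hm
    have hmem : m ∈ E.supp t := Nat.sInf_mem (E.supp_nonempty ht0)
    have hmN : N ≤ m := E.le_of_mem_tail ht hmem
    have hb := hx.update (fun i hi n hn => (hN₃ i hi n hn).trans_le hN3) ht ht0
    have hb1 : ∀ n < k + 1, ‖Function.update x k t n‖ = 1 := fun n hn => by
      rcases (Nat.lt_succ_iff.mp hn).lt_or_eq with h | rfl
      · rw [Function.update_of_ne h.ne]
        exact hx1 n h
      · simpa using ht1
    have hw := ih z' hz' (k + 1) _ hb hb1
    have hupd := blockTransfer_update v E C⁻¹ k x t z'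
    refine ⟨_, ⟨?_, hw⟩, ?_⟩
    · rw [hupd]
      refine hAU z' hz'A _ ?_ m (hN1.trans hmN)
      rw [abs_mul, abs_of_pos hC0]
      exact mul_le_one₀ hC1 (abs_nonneg _) hz'tu
    · refine lt_of_lt_of_le ?_ (abs_le_norm_blockTransfer_update_sub hv_norm C⁻¹ x t
        (fun i hi => ?_) z' z)
      · rw [abs_mul, abs_of_pos hC0]
        exact mul_lt_mul_of_pos_left hz'tl hC0
      · have := hN₃ i hi _ (hx.sInf_mem (by exact_mod_cast hi))
        lia

end Transfer

theorem corollary4p5 {V Z : Type*}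
    [NormedAddCommGroup V] [NormedSpace ℝ V] [CompleteSpace V]
    [NormedAddCommGroup Z] [NormedSpace ℝ Z] [CompleteSpace Z]
    (v : SchauderBasis ℝ V) (hv_norm : v.IsNormalized) (hv_unc : v.IsOneUnconditional)
    (hv_shr : v.toFDD.IsShrinking)
    (E : FDD Z) (hE_shr : E.IsShrinking) (hE : E.SatisfiesUpperBlockEstimates v) :
    szlenkIndex Z ≤ szlenkIndex V := by
  obtain ⟨C, hC, hdom⟩ := hE
  refine Ordinal.iSup_le fun ⟨ε, hε⟩ => ?_
  have hpos : 0 < C⁻¹ * (ε / 16) := mul_pos (inv_pos.mpr (by linarith)) (by linarith)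
  refine le_trans (szlenkEta_le_of_forall_eq_empty fun α hα => ?_)
    (szlenkEta_le_szlenkIndex hpos)
  refine Set.eq_empty_of_forall_notMem fun z hz => ?_
  -- The empty block sequence transfers `z` to the zero functional.
  have h0 := blockTransfer_mem_szlenkDerived hv_norm hv_unc hE_shr hC hdom hε α z hz 0 (fun _ => 0)
    ⟨by simp, by simp, by simp⟩ (by simp)
  rw [hα] at h0
  exact h0
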